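/- **Lemma 4.1.** Let $P\ge 1$, $0\le\mathcal O<P$ and $1\le k\le P$ be fixed integers. For every sample size $n>P$ consider the linear regression model $Y=X\theta+u$, where $X=X_n$ is a non-stochastic $n\times P$ matrix of rank $P$, $\theta\in\mathbb R^P$, and $u\sim N(0,\sigma^2I_n)$ with $\sigma>0$; assume that $Q=\lim_{n\to\infty}X'X/n$ exists and is non-singular. Let $P_{n,\theta,\sigma}$ denote the corresponding probability measure. Let $A$ be a fixed $k\times P$ matrix of rank $k$. For a matrix $D$ with $P$ columns let $D[p]$ be the matrix of its first $p$ columns. For $0\le p\le P$ let $\tilde\theta(p)\in\mathbb R^P$ be the restricted least-squares estimator of order $p$: its first $p$ components are $(X[p]'X[p])^{-1}X[p]'Y$ and its last $P-p$ components are zero (so $\tilde\theta(0)=0$). Let $\hat\sigma^2=(n-P)^{-1}(Y-X\tilde\theta(P))'(Y-X\tilde\theta(P))$, let $\xi_{n,p}=\bigl(\bigl[(X[p]'X[p]/n)^{-1}\bigr]_{p,p}\bigr)^{1/2}$ for $0<p\le P$, and put $T_0=T_0^*=0$ and, for $0<p\le P$, $$T_p=\frac{\sqrt n\,\tilde\theta_p(p)}{\hat\sigma\,\xi_{n,p}},\qquad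 T_p^*=\frac{\sqrt n\,\tilde\theta_p(p)}{\sigma\,\xi_{n,p}},$$ where $\tilde\theta_p(p)$ is the $p$-th component of $\tilde\theta(p)$. Let the critical values $c_p$ not depend on $n$ and satisfy $c_{\mathcal O}=0$ and $0<c_p<\infty$ for $\mathcal O<p\le P$. Define the model selectors and the post-model-selection estimators $$\hat p=\max\{p:|T_p|\ge c_p,\ 0\le p\le P\},\qquad \hat p^*=\max\{p:|T_p^*|\ge c_p,\ 0\le p\le P\},$$ $$\tilde\theta=\sum_{p=\mathcal O}^P\tilde\theta(p)\mathbf 1\{\hat p=p\},\qquad \tilde\theta^*=\sum_{p=\mathcal O}^P\tilde\theta(p)\mathbf 1\{\hat p^*=p\}.$$ For $\mathcal O\le p\le P$ let $\pi_{n,\theta,\sigma}(p)=P_{n,\theta,\sigma}(\hat p=p)$ and $\pi^*_{n,\theta,\sigma}(p)=P_{n,\theta,\sigma}(\hat p^*=p)$; let $G_{n,\theta,\sigma}(\cdot|p)$ be the conditional distribution on $\mathbb R^k$ of $\sqrt nA(\tilde\theta-\theta)$ given $\hat p=p$ under $P_{n,\theta,\sigma}$, and let $G^*_{n,\theta,\sigma}(\cdot|p)$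 be the conditional distribution of $\sqrt nA(\tilde\theta^*-\theta)$ given $\hat p^*=p$. For finite measures $\mu,\nu$ on $\mathbb R^k$ let $\|\mu-\nu\|_{TV}=|\mu-\nu|(\mathbb R^k)$ be the total variation of the signed measure $\mu-\nu$. Then, for each $p$ with $\mathcal O\le p\le P$, $$\sup_{\theta\in\mathbb R^P,\ \sigma>0}\bigl\|G_{n,\theta,\sigma}(\cdot|p)\,\pi_{n,\theta,\sigma}(p)-G^*_{n,\theta,\sigma}(\cdot|p)\,\pi^*_{n,\theta,\sigma}(p)\bigr\|_{TV}\longrightarrow 0\qquad(n\to\infty).$$ -/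

import Mathlib

open MeasureTheory ProbabilityTheory Filter Topology Matrix
open scoped ENNReal NNReal

namespace PostModelSelection

noncomputable section

/-- `D[p]`: the matrix of the first `p` columns of `D` (no columns if `p = 0`, all if `p = P`). -/
def firstCols {m P : ℕ} (D : Matrix (Fin m) (Fin P) ℝ) (p : ℕ) :
    Matrix (Fin m) {j : Fin P // (j : ℕ) < p} ℝ :=
  D.submatrix id Subtype.val

/-- The restricted least-squares estimator of order `p`: its first `p` components are
`(X[p]' X[p])⁻¹ X[p]' y`, its last `P - p` components are zero. -/
def restrictedLS {n P : ℕ} (X : Matrix (Fin n) (Fin P) ℝ) (p : ℕ) (y : Fin n → ℝ) : Fin P → ℝ :=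
  fun j => if h : (j : ℕ) < p then
    (((firstCols X p)ᵀ * firstCols X p)⁻¹ *ᵥ ((firstCols X p)ᵀ *ᵥ y)) ⟨j, h⟩ else 0

/-- The residual vector of the overall model. -/
def residual {n P : ℕ} (X : Matrix (Fin n) (Fin P) ℝ) (y : Fin n → ℝ) : Fin n → ℝ :=
  y - X *ᵥ restrictedLS X P y

/-- The standard deviation estimator of the overall model,
the square root of `(n - P)⁻¹ (y - X θ̃(P))' (y - X θ̃(P))`. -/
def sigmaHat {n P : ℕ} (X : Matrix (Fin n) (Fin P) ℝ) (y : Fin n → ℝ) : ℝ :=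
  √(((n : ℝ) - (P : ℝ))⁻¹ * (residual X y ⬝ᵥ residual X y))

/-- With `p = q + 1`, the square root of the `p`-th (that is, last) diagonal element of
`(X[p]' X[p] / n)⁻¹`. The index `q : Fin P` counts from zero. -/
def xi {n P : ℕ} (X : Matrix (Fin n) (Fin P) ℝ) (q : Fin P) : ℝ :=
  √(((n : ℝ)⁻¹ • ((firstCols X (q + 1))ᵀ * firstCols X (q + 1)))⁻¹
    ⟨q, Nat.lt_succ_self q⟩ ⟨q, Nat.lt_succ_self q⟩)

/-- The test statistic of order `p`, with the error standard deviation taken to be `s`: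
zero for `p = 0`, and `√n θ̃_p(p) / (s ξ_{n,p})` for `1 ≤ p ≤ P`
(the `p`-th component has index `p - 1`). It is not used for `p > P`. -/
def testStat {n P : ℕ} (X : Matrix (Fin n) (Fin P) ℝ) (s : ℝ) (y : Fin n → ℝ) : ℕ → ℝ
  | 0 => 0
  | q + 1 => if h : q < P then
      √(n : ℝ) * restrictedLS X (q + 1) y ⟨q, h⟩ / (s * xi X ⟨q, h⟩) else 0

open Classical in
/-- `max {p : |T_p| ≥ c_p, 0 ≤ p ≤ P}`, with the error standard deviation taken to be `s`. -/
def selectOrder {n P : ℕ} (c : ℕ → ℝ) (X : Matrix (Fin n) (Fin P) ℝ) (s : ℝ) (y : Fin n → ℝ) : ℕ :=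
  Nat.findGreatest (fun p => c p ≤ |testStat X s y p|) P

/-- The model selector: the error variance is estimated from the overall model. -/
def orderHat {n P : ℕ} (c : ℕ → ℝ) (X : Matrix (Fin n) (Fin P) ℝ) (y : Fin n → ℝ) : ℕ :=
  selectOrder c X (sigmaHat X y) y

/-- The idealized model selector: the error standard deviation `σ` is known. -/
def orderStar {n P : ℕ} (c : ℕ → ℝ) (X : Matrix (Fin n) (Fin P) ℝ) (σ : ℝ) (y : Fin n → ℝ) : ℕ :=
  selectOrder c X σ y

/-- The post-model-selection estimator that belongs to the model selector `sel`:
the sum over `O ≤ p ≤ P` of `θ̃(p) 1{sel = p}`. -/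
def postEstimator {n P : ℕ} (O : ℕ) (X : Matrix (Fin n) (Fin P) ℝ) (sel : (Fin n → ℝ) → ℕ)
    (y : Fin n → ℝ) : Fin P → ℝ :=
  ∑ p ∈ Finset.Icc O P, if sel y = p then restrictedLS X p y else 0

/-- The law `P_{n,θ,σ}` of `Y = X θ + u`, where `u ~ N(0, σ² I_n)`, that is, the components of `u`
are independent with law `N(0, σ²)`. -/
def sampleLaw {n P : ℕ} (X : Matrix (Fin n) (Fin P) ℝ) (θ : Fin P → ℝ) (σ : ℝ) :
    Measure (Fin n → ℝ) :=
  (Measure.pi fun _ : Fin n => gaussianReal 0 (σ ^ 2).toNNReal).map fun u => X *ᵥ θ + u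

instance {n P : ℕ} (X : Matrix (Fin n) (Fin P) ℝ) (θ : Fin P → ℝ) (σ : ℝ) :
    IsProbabilityMeasure (sampleLaw X θ σ) :=
  Measure.isProbabilityMeasure_map (by fun_prop)

/-- The scaled and centered linear function `√n A (θ̃ - θ)` of the post-model-selection estimator
that belongs to the model selector `sel`. -/
def scaledError {n P k : ℕ} (O : ℕ) (A : Matrix (Fin k) (Fin P) ℝ) (X : Matrix (Fin n) (Fin P) ℝ)
    (θ : Fin P → ℝ) (sel : (Fin n → ℝ) → ℕ) (y : Fin n → ℝ) : Fin k → ℝ :=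
  √(n : ℝ) • (A *ᵥ (postEstimator O X sel y - θ))

/-- The model selection probability `P_{n,θ,σ}(sel = p)`. -/
def selProb {n P : ℕ} (X : Matrix (Fin n) (Fin P) ℝ) (θ : Fin P → ℝ) (σ : ℝ)
    (sel : (Fin n → ℝ) → ℕ) (p : ℕ) : ℝ :=
  (sampleLaw X θ σ).real {y | sel y = p}

/-- The conditional distribution, on `ℝ^k`, of `√n A (θ̃ - θ)` given `sel = p`. -/
def condLaw {n P k : ℕ} (O : ℕ) (A : Matrix (Fin k) (Fin P) ℝ) (X : Matrix (Fin n) (Fin P) ℝ)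
    (θ : Fin P → ℝ) (σ : ℝ) (sel : (Fin n → ℝ) → ℕ) (p : ℕ) : Measure (Fin k → ℝ) :=
  (ProbabilityTheory.cond (sampleLaw X θ σ) {y | sel y = p}).map (scaledError O A X θ sel)

instance {n P k : ℕ} (O : ℕ) (A : Matrix (Fin k) (Fin P) ℝ) (X : Matrix (Fin n) (Fin P) ℝ)
    (θ : Fin P → ℝ) (σ : ℝ) (sel : (Fin n → ℝ) → ℕ) (p : ℕ) :
    IsFiniteMeasure (condLaw O A X θ σ sel p) := by
  unfold condLaw; infer_instance

/-- The conditional distribution given `sel = p`, multiplied by the probability of `sel = p`. -/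
def weightedCondLaw {n P k : ℕ} (O : ℕ) (A : Matrix (Fin k) (Fin P) ℝ)
    (X : Matrix (Fin n) (Fin P) ℝ) (θ : Fin P → ℝ) (σ : ℝ) (sel : (Fin n → ℝ) → ℕ) (p : ℕ) :
    SignedMeasure (Fin k → ℝ) :=
  selProb X θ σ sel p • (condLaw O A X θ σ sel p).toSignedMeasure

/-- The total variation distance `|μ - ν|(ℝ^k)` of two finite (signed) measures. -/
def tvDistance {k : ℕ} (μ ν : SignedMeasure (Fin k → ℝ)) : ℝ≥0∞ :=
  (μ - ν).variation Set.univ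

end

end PostModelSelection

/-!
On the event that the order `p` is selected, both post-model-selection estimators coincide with the
same restricted least-squares estimator. The two weighted conditional laws are therefore images,
under one map, of the sample law restricted to the two selection events, and their total variation
distance is at most the probability that exactly one of the selectors picks `p`
(`tvDistance_weightedCondLaw_le`).

For the selectors to differ, some test of order `q > O` must come out differently with `σ̂` than
with `σ`. Since `T_q = T_q^* σ / σ̂`, this forces either `|σ̂ / σ - 1| ≥ δ` or that `|T_q^*|` lies
within `c_q δ` of `c_q` (`sampleLaw_symmDiff_orderHat_orderStar_le`). Both are controlled
uniformly in `θ` and `σ`: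

* `T_q^*` is normal with variance one and some mean depending on `θ` and `σ`
  (`exists_testStat_eq_affine`). The normal density is at most one, so `|T_q^*|` is within `c_q δ`
  of `c_q` with probability at most `4 c_q δ`, whatever the mean
  (`sampleLaw_abs_testStat_near_le`).
* Writing `Y = X θ + σ z` with `z` standard normal, `σ̂² / σ²` equals `(z'z - |Hz|²) / (n - P)`,
  with `H` the hat matrix, which is free of `θ` and `σ`. Chebyshev's inequality for `z'z` and
  Markov's inequality for `|Hz|²`, whose mean is the trace `P` of `H`, show that `σ̂ / σ` tends to
  one in probability (`sampleLaw_sigmaHat_div_sub_one_ge_le`).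

Neither independence of `σ̂` and `T_q^*` nor the exact law of `σ̂` enters: a union bound suffices.
-/

namespace PostModelSelection

/-! ### Standard Gaussian vectors -/

/-- The standard normal law `N(0, I)` on `ι → ℝ`, as a product of one-dimensional laws. -/
noncomputable def stdNormal (ι : Type*) [Fintype ι] : Measure (ι → ℝ) :=
  Measure.pi fun _ => gaussianReal 0 1

instance (ι : Type*) [Fintype ι] : IsProbabilityMeasure (stdNormal ι) := by
  unfold stdNormal; infer_instance

theorem stdNormal_map_dotProduct {ι : Type*} [Fintype ι] (a : ι → ℝ) :
    (stdNormal ι).map (fun z => a ⬝ᵥ z) = gaussianReal 0 (a ⬝ᵥ a).toNNReal := by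
  have hmeas : Measurable fun z : ι → ℝ => a ⬝ᵥ z := by unfold dotProduct; fun_prop
  have hlaw (i : ι) : HasLaw (fun z : ι → ℝ => z i) (gaussianReal 0 1) (stdNormal ι) :=
    ⟨(measurable_pi_apply i).aemeasurable, (measurePreserving_eval _ i).map_eq⟩
  have hind : iIndepFun (fun i (z : ι → ℝ) => a i * z i) (stdNormal ι) :=
    iIndepFun_pi (X := fun i x => a i * x) (fun i => by fun_prop)
  have hG : HasGaussianLaw (fun z : ι → ℝ => ∑ i, a i * z i) (stdNormal ι) := by
    refine hind.hasGaussianLaw_fun_sum fun i => ?_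
    have h := gaussianReal_const_mul (hlaw i) (a i)
    exact ⟨by rw [h.map_eq]; infer_instance⟩
  have hL2 (i : ι) : MemLp (fun x : ℝ => a i * x) 2 (gaussianReal 0 1) :=
    (memLp_id_gaussianReal 2).const_mul (a i)
  have hmean : ∫ z, a ⬝ᵥ z ∂(stdNormal ι) = 0 := by
    simp only [dotProduct]
    rw [integral_finsetSum]
    · refine Finset.sum_eq_zero fun i _ => ?_
      rw [integral_const_mul, (hlaw i).integral_eq]
      simp
    · intro i _
      have := (hL2 i).comp_measurePreserving
        (measurePreserving_eval (fun _ : ι => gaussianReal 0 1) i)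
      exact this.integrable (by norm_num)
  have hvar : Var[fun z => a ⬝ᵥ z; stdNormal ι] = a ⬝ᵥ a := by
    have h := variance_sum_pi (μ := fun _ : ι => gaussianReal 0 1) (X := fun i x => a i * x) hL2
    rw [show (fun z => a ⬝ᵥ z) = ∑ i, fun z : ι → ℝ => a i * z i by
      ext z; simp [dotProduct], stdNormal, h]
    refine Finset.sum_congr rfl fun i _ => ?_
    rw [variance_const_mul, variance_fun_id_gaussianReal]
    simp [sq]
  have h1 := IsGaussian.eq_gaussianReal _ hG.isGaussian_map
  change (stdNormal ι).map (fun z => a ⬝ᵥ z) =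
    gaussianReal (∫ x, x ∂((stdNormal ι).map (fun z => a ⬝ᵥ z)))
      Var[id; (stdNormal ι).map (fun z => a ⬝ᵥ z)].toNNReal at h1
  rwa [integral_map hmeas.aemeasurable (by fun_prop), hmean,
    variance_map (by fun_prop) hmeas.aemeasurable, Function.id_comp, hvar] at h1

theorem lintegral_sq_dotProduct_stdNormal {ι : Type*} [Fintype ι] (a : ι → ℝ) :
    ∫⁻ z, ENNReal.ofReal ((a ⬝ᵥ z) ^ 2) ∂(stdNormal ι) = ENNReal.ofReal (a ⬝ᵥ a) := by
  have hmeas : Measurable fun z : ι → ℝ => a ⬝ᵥ z := by unfold dotProduct; fun_prop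
  rw [← lintegral_map (f := fun x : ℝ => ENNReal.ofReal (x ^ 2)) (by fun_prop) hmeas,
    stdNormal_map_dotProduct, ← ofReal_integral_eq_lintegral_ofReal]
  · congr 1
    have h := variance_eq_integral (μ := gaussianReal 0 (a ⬝ᵥ a).toNNReal) (X := id) (by fun_prop)
    have h0 : 0 ≤ a ⬝ᵥ a := Finset.sum_nonneg fun i _ => mul_self_nonneg _
    simpa [variance_id_gaussianReal, h0] using h.symm
  · exact (memLp_id_gaussianReal 2).integrable_sq
  · exact ae_of_all _ fun x => sq_nonneg _

/-- The standard normal density is at most one, so an affine function of a Gaussian vector with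
standard deviation one falls into an interval with probability at most the interval's length,
whatever its mean. -/
theorem stdNormal_affine_mem_Icc_le {ι : Type*} [Fintype ι] (a : ι → ℝ) (ha : a ⬝ᵥ a = 1)
    (m l r : ℝ) :
    stdNormal ι {z | m + a ⬝ᵥ z ∈ Set.Icc l r} ≤ ENNReal.ofReal (r - l) := by
  have hmeas : Measurable fun z : ι → ℝ => a ⬝ᵥ z := by unfold dotProduct; fun_prop
  have hset : {z : ι → ℝ | m + a ⬝ᵥ z ∈ Set.Icc l r}
      = (fun z => a ⬝ᵥ z) ⁻¹' Set.Icc (l - m) (r - m) := by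
    ext z
    simp only [Set.mem_ofPred_eq, Set.mem_Icc, Set.mem_preimage]
    constructor <;> rintro ⟨h1, h2⟩ <;> constructor <;> linarith
  rw [hset, ← Measure.map_apply hmeas measurableSet_Icc, stdNormal_map_dotProduct, ha,
    Real.toNNReal_one, gaussianReal_apply _ one_ne_zero]
  have hpdf (x : ℝ) : gaussianPDF 0 1 x ≤ 1 := by
    rw [gaussianPDF, ← ENNReal.ofReal_one]
    refine ENNReal.ofReal_le_ofReal ?_
    have h1 : 1 ≤ √(2 * Real.pi * ((1 : ℝ≥0) : ℝ)) := by
      rw [Real.one_le_sqrt]; norm_num; linarith [Real.pi_gt_three]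
    have h2 : Real.exp (-(x - 0) ^ 2 / (2 * ((1 : ℝ≥0) : ℝ))) ≤ 1 := by
      rw [Real.exp_le_one_iff]
      exact div_nonpos_of_nonpos_of_nonneg (neg_nonpos.2 (sq_nonneg _)) (by positivity)
    exact mul_le_one₀ (inv_le_one_of_one_le₀ h1) (Real.exp_pos _).le h2
  calc ∫⁻ x in Set.Icc (l - m) (r - m), gaussianPDF 0 1 x
      ≤ ∫⁻ _ in Set.Icc (l - m) (r - m), 1 := lintegral_mono hpdf
    _ = ENNReal.ofReal (r - l) := by simp

/-- The variance of the square of a standard normal variable. Its value does not matter, only that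
it does not depend on the dimension. -/
noncomputable def varSq : ℝ := Var[fun x => x ^ 2; gaussianReal 0 1]

/-- Chebyshev's inequality for the squared length of a standard Gaussian vector. -/
theorem stdNormal_dotProduct_self_sub_ge_le (n : ℕ) {t : ℝ} (ht : 0 < t) :
    stdNormal (Fin n) {z | t ≤ |z ⬝ᵥ z - n|} ≤ ENNReal.ofReal (n * varSq / t ^ 2) := by
  have hsum : (fun z : Fin n → ℝ => z ⬝ᵥ z) = ∑ i, fun z : Fin n → ℝ => (z i) ^ 2 := by
    ext z; simp [dotProduct, sq]
  have hL2 : MemLp (fun x : ℝ => x ^ 2) 2 (gaussianReal 0 1) := by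
    have h4 : MemLp (fun x : ℝ => x) 4 (gaussianReal 0 1) := memLp_id_gaussianReal 4
    have := h4.mul (r := 2) (q := 4) (p := 4) h4 (hpqr := ⟨by
      rw [show (4 : ℝ≥0∞) = 2 * 2 by norm_num, ENNReal.mul_inv (by simp) (by simp), ← mul_add,
        ENNReal.inv_two_add_inv_two, mul_one]⟩)
    simpa [sq, Pi.mul_def] using this
  have hL2' (i : Fin n) : MemLp (fun z : Fin n → ℝ => (z i) ^ 2) 2 (stdNormal (Fin n)) :=
    hL2.comp_measurePreserving (measurePreserving_eval (fun _ : Fin n => gaussianReal 0 1) i)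
  have hmem : MemLp (fun z : Fin n → ℝ => z ⬝ᵥ z) 2 (stdNormal (Fin n)) := by
    rw [hsum]; exact memLp_finsetSum' _ fun i _ => hL2' i
  have hvar : Var[fun z : Fin n → ℝ => z ⬝ᵥ z; stdNormal (Fin n)] = n * varSq := by
    rw [hsum, stdNormal, variance_sum_pi (X := fun _ x => x ^ 2) (fun _ => hL2)]
    simp [varSq]
  have hone : ∫ x, x ^ 2 ∂(gaussianReal 0 1) = 1 := by
    have h := variance_eq_integral (μ := gaussianReal 0 1) (X := id) (by fun_prop)
    simpa [variance_id_gaussianReal] using h.symm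
  have hmean : ∫ z, z ⬝ᵥ z ∂(stdNormal (Fin n)) = n := by
    simp only [dotProduct, ← sq]
    rw [integral_finsetSum _ fun i _ => (hL2' i).integrable (by norm_num)]
    have hi (i : Fin n) : ∫ z, (z i) ^ 2 ∂(stdNormal (Fin n)) = 1 := by
      rw [← hone]
      exact (HasLaw.mk (measurable_pi_apply i).aemeasurable
        (measurePreserving_eval (fun _ : Fin n => gaussianReal 0 1) i).map_eq).integral_comp
          (f := fun x : ℝ => x ^ 2) (by fun_prop)
    simp [hi]
  have h := meas_ge_le_variance_div_sq hmem ht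
  rwa [hmean, hvar] at h

/-- Markov's inequality for the squared length of the linear image of a standard Gaussian vector. -/
theorem stdNormal_mulVec_dotProduct_ge_le {n : ℕ} (H : Matrix (Fin n) (Fin n) ℝ)
    {t : ℝ} (ht : 0 < t) :
    stdNormal (Fin n) {z | t ≤ (H *ᵥ z) ⬝ᵥ (H *ᵥ z)}
      ≤ ENNReal.ofReal ((H * Hᵀ).trace / t) := by
  have hsum (z : Fin n → ℝ) : ENNReal.ofReal ((H *ᵥ z) ⬝ᵥ (H *ᵥ z))
      = ∑ i, ENNReal.ofReal ((H.row i ⬝ᵥ z) ^ 2) := by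
    rw [← ENNReal.ofReal_sum_of_nonneg fun i _ => sq_nonneg _]
    simp [dotProduct, mulVec, sq]
  have hint : ∫⁻ z, ENNReal.ofReal ((H *ᵥ z) ⬝ᵥ (H *ᵥ z)) ∂(stdNormal (Fin n))
      = ENNReal.ofReal (H * Hᵀ).trace := by
    simp_rw [hsum]
    rw [lintegral_finsetSum _ fun i _ => by unfold dotProduct; fun_prop]
    simp_rw [lintegral_sq_dotProduct_stdNormal]
    rw [← ENNReal.ofReal_sum_of_nonneg (f := fun i => H.row i ⬝ᵥ H.row i)
      fun i _ => Finset.sum_nonneg fun j _ => mul_self_nonneg _]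
    simp [Matrix.trace, Matrix.mul_apply, dotProduct]
  have h := meas_ge_le_lintegral_div (μ := stdNormal (Fin n))
    (f := fun z => ENNReal.ofReal ((H *ᵥ z) ⬝ᵥ (H *ᵥ z)))
    (by unfold mulVec dotProduct; fun_prop) (ε := ENNReal.ofReal t) (by simpa using ht) (by simp)
  rw [hint, ← ENNReal.ofReal_div_of_pos ht] at h
  refine (measure_mono fun z hz => ?_).trans h
  exact ENNReal.ofReal_le_ofReal hz


/-! ### Least squares in the fixed-design model -/

theorem firstCols_mulVec_injective {n P : ℕ} {X : Matrix (Fin n) (Fin P) ℝ} (hX : X.rank = P)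
    (p : ℕ) : Function.Injective (firstCols X p).mulVec := by
  rw [mulVec_injective_iff]
  have h : LinearIndependent ℝ X.col := by
    rw [linearIndependent_iff_card_eq_finrank_span, Set.finrank, ← rank_eq_finrank_span_cols, hX,
      Fintype.card_fin]
  exact h.comp _ Subtype.val_injective

theorem posDef_gram_firstCols {n P : ℕ} {X : Matrix (Fin n) (Fin P) ℝ} (hX : X.rank = P)
    (p : ℕ) : ((firstCols X p)ᵀ * firstCols X p).PosDef := by
  have h := PosDef.conjTranspose_mul_self _ (firstCols_mulVec_injective hX p)
  rwa [conjTranspose_eq_transpose_of_trivial] at h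

/-- The hat matrix of the overall model, the orthogonal projection onto the column space of `X`. -/
noncomputable def hatMatrix {n P : ℕ} (X : Matrix (Fin n) (Fin P) ℝ) :
    Matrix (Fin n) (Fin n) ℝ :=
  firstCols X P * ((firstCols X P)ᵀ * firstCols X P)⁻¹ * (firstCols X P)ᵀ

theorem hatMatrix_transpose {n P : ℕ} (X : Matrix (Fin n) (Fin P) ℝ) :
    (hatMatrix X)ᵀ = hatMatrix X := by
  simp [hatMatrix, transpose_nonsing_inv, Matrix.mul_assoc]

theorem hatMatrix_mul_firstCols {n P : ℕ} {X : Matrix (Fin n) (Fin P) ℝ} (hX : X.rank = P) :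
    hatMatrix X * firstCols X P = firstCols X P := by
  have hu := (posDef_gram_firstCols hX P).det_pos.ne'.isUnit
  rw [hatMatrix, Matrix.mul_assoc, Matrix.mul_assoc, nonsing_inv_mul _ hu, Matrix.mul_one]

theorem hatMatrix_mul_self {n P : ℕ} {X : Matrix (Fin n) (Fin P) ℝ} (hX : X.rank = P) :
    hatMatrix X * hatMatrix X = hatMatrix X := by
  nth_rw 2 [hatMatrix]
  rw [← Matrix.mul_assoc, ← Matrix.mul_assoc, hatMatrix_mul_firstCols hX, ← hatMatrix]

theorem trace_hatMatrix {n P : ℕ} {X : Matrix (Fin n) (Fin P) ℝ} (hX : X.rank = P) :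
    (hatMatrix X).trace = P := by
  have hu := (posDef_gram_firstCols hX P).det_pos.ne'.isUnit
  rw [hatMatrix, Matrix.mul_assoc, trace_mul_comm, Matrix.mul_assoc, nonsing_inv_mul _ hu,
    trace_one]
  simp

theorem mulVec_eq_firstCols_mulVec {n P : ℕ} (X : Matrix (Fin n) (Fin P) ℝ) (v : Fin P → ℝ) :
    X *ᵥ v = firstCols X P *ᵥ fun j => v j := by
  ext i
  simp only [mulVec, dotProduct, firstCols, submatrix_apply, id]
  exact (Fintype.sum_equiv (Equiv.subtypeUnivEquiv fun j : Fin P => j.isLt) _ _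
    fun _ => rfl).symm

theorem mulVec_restrictedLS {n P : ℕ} (X : Matrix (Fin n) (Fin P) ℝ) (y : Fin n → ℝ) :
    X *ᵥ restrictedLS X P y = hatMatrix X *ᵥ y := by
  rw [mulVec_eq_firstCols_mulVec, hatMatrix, ← mulVec_mulVec, ← mulVec_mulVec]
  congr 1
  ext j
  simp [restrictedLS]

/-- The residual sum of squares does not depend on `θ`, and by Pythagoras it differs from the
squared length of the errors by the squared length of their projection. -/
theorem residual_dotProduct_self {n P : ℕ} {X : Matrix (Fin n) (Fin P) ℝ} (hX : X.rank = P)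
    (θ : Fin P → ℝ) (σ : ℝ) (z : Fin n → ℝ) :
    residual X (X *ᵥ θ + σ • z) ⬝ᵥ residual X (X *ᵥ θ + σ • z)
      = σ ^ 2 * (z ⬝ᵥ z - (hatMatrix X *ᵥ z) ⬝ᵥ (hatMatrix X *ᵥ z)) := by
  have h1 : residual X (X *ᵥ θ + σ • z) = σ • (z - hatMatrix X *ᵥ z) := by
    rw [residual, mulVec_restrictedLS, mulVec_add, mulVec_smul, mulVec_eq_firstCols_mulVec X θ,
      mulVec_mulVec, hatMatrix_mul_firstCols hX, smul_sub]
    abel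
  have h2 : z ⬝ᵥ hatMatrix X *ᵥ z = (hatMatrix X *ᵥ z) ⬝ᵥ (hatMatrix X *ᵥ z) := by
    nth_rw 1 [← hatMatrix_mul_self hX]
    rw [← mulVec_mulVec, dotProduct_mulVec, ← mulVec_transpose, hatMatrix_transpose]
  rw [h1]
  simp only [smul_dotProduct, dotProduct_smul, sub_dotProduct, dotProduct_sub, smul_eq_mul]
  rw [dotProduct_comm (hatMatrix X *ᵥ z) z, h2]
  ring

/-- With the true standard deviation, the test statistic is an affine function of the standardized
errors whose linear part has unit length; hence it is normal with unit variance. -/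
theorem exists_testStat_eq_affine {n P : ℕ} {X : Matrix (Fin n) (Fin P) ℝ} (hX : X.rank = P)
    (hn : 0 < n) {q : ℕ} (hq : q < P) (θ : Fin P → ℝ) {σ : ℝ} (hσ : 0 < σ) :
    ∃ (m : ℝ) (a : Fin n → ℝ), a ⬝ᵥ a = 1 ∧
      ∀ z, testStat X σ (X *ᵥ θ + σ • z) (q + 1) = m + a ⬝ᵥ z := by
  set M := firstCols X (q + 1) with hM
  set G := Mᵀ * M with hG
  have hpd : G.PosDef := posDef_gram_firstCols hX (q + 1)
  have hu : IsUnit G.det := hpd.det_pos.ne'.isUnit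
  let i : {j : Fin P // (j : ℕ) < q + 1} := ⟨⟨q, hq⟩, Nat.lt_succ_self q⟩
  have hn' : (0 : ℝ) < n := by exact_mod_cast hn
  set b : Fin n → ℝ := (G⁻¹ * Mᵀ) i with hb
  have hbb : b ⬝ᵥ b = G⁻¹ i i := by
    have h : b ⬝ᵥ b = ((G⁻¹ * Mᵀ) * (G⁻¹ * Mᵀ)ᵀ) i i := by
      rw [Matrix.mul_apply]; rfl
    have hGt : Gᵀ = G := by simp [hG]
    rw [h, transpose_mul, transpose_transpose, transpose_nonsing_inv, hGt, ← Matrix.mul_assoc,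
      Matrix.mul_assoc G⁻¹, ← hG, nonsing_inv_mul _ hu, Matrix.one_mul]
  have hxi : xi X ⟨q, hq⟩ = √(n * (b ⬝ᵥ b)) := by
    rw [hbb, xi]
    congr 1
    change ((n : ℝ)⁻¹ • G)⁻¹ i i = _
    have : ((n : ℝ)⁻¹ • G)⁻¹ = (n : ℝ) • G⁻¹ := by
      refine inv_eq_right_inv ?_
      rw [Matrix.smul_mul, Matrix.mul_smul, smul_smul, inv_mul_cancel₀ hn'.ne', mul_nonsing_inv _ hu,
        one_smul]
    rw [this]; rfl
  have hbpos : 0 < b ⬝ᵥ b := hbb ▸ hpd.inv.diag_pos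
  have hLS (y : Fin n → ℝ) : restrictedLS X (q + 1) y ⟨q, hq⟩ = b ⬝ᵥ y := by
    rw [restrictedLS, dif_pos (Nat.lt_succ_self q), mulVec_mulVec]
    rfl
  have hs : 0 < √(b ⬝ᵥ b) := Real.sqrt_pos.2 hbpos
  have hsn : 0 < √(n : ℝ) := Real.sqrt_pos.2 hn'
  refine ⟨(b ⬝ᵥ X *ᵥ θ) / (σ * √(b ⬝ᵥ b)), (√(b ⬝ᵥ b))⁻¹ • b, ?_, fun z => ?_⟩
  · rw [smul_dotProduct, dotProduct_smul, smul_eq_mul, smul_eq_mul]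
    nth_rw 3 [← Real.mul_self_sqrt hbpos.le]
    field_simp
  · rw [testStat, dif_pos hq, hLS, hxi, Real.sqrt_mul hn'.le, dotProduct_add, dotProduct_smul,
      smul_dotProduct, smul_eq_mul, smul_eq_mul]
    field_simp

theorem testStat_eq_mul_div {n P : ℕ} (X : Matrix (Fin n) (Fin P) ℝ) (s : ℝ) {σ : ℝ} (hσ : σ ≠ 0)
    (y : Fin n → ℝ) (q : ℕ) : testStat X s y q = testStat X σ y q * (σ / s) := by
  rcases q with _ | q
  · simp [testStat]
  · simp only [testStat]
    split_ifs
    · rw [mul_comm s, mul_comm σ, ← div_div, ← div_div]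
      field_simp
    · simp

theorem measurable_restrictedLS {n P : ℕ} (X : Matrix (Fin n) (Fin P) ℝ) (p : ℕ) :
    Measurable (restrictedLS X p) := by
  refine measurable_pi_lambda _ fun j => ?_
  by_cases h : (j : ℕ) < p
  · simp only [restrictedLS, dif_pos h, mulVec, dotProduct]
    fun_prop
  · simp only [restrictedLS, dif_neg h]
    fun_prop

theorem measurable_sigmaHat {n P : ℕ} (X : Matrix (Fin n) (Fin P) ℝ) :
    Measurable (sigmaHat X) := by
  have := measurable_restrictedLS X P
  unfold sigmaHat residual mulVec dotProduct
  fun_prop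

theorem measurable_testStat {n P : ℕ} (X : Matrix (Fin n) (Fin P) ℝ) {s : (Fin n → ℝ) → ℝ}
    (hs : Measurable s) (q : ℕ) : Measurable fun y => testStat X (s y) y q := by
  rcases q with _ | q
  · simp only [testStat]; fun_prop
  · by_cases h : q < P
    · have := measurable_restrictedLS X (q + 1)
      simp only [testStat, dif_pos h]
      fun_prop
    · simp only [testStat, dif_neg h]
      fun_prop

theorem measurable_selectOrder {n P : ℕ} (c : ℕ → ℝ) (X : Matrix (Fin n) (Fin P) ℝ)
    {s : (Fin n → ℝ) → ℝ} (hs : Measurable s) : Measurable fun y => selectOrder c X (s y) y := by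
  unfold selectOrder
  exact measurable_findGreatest fun q _ =>
    measurableSet_le measurable_const (measurable_testStat X hs q).abs

theorem sampleLaw_eq_map_stdNormal {n P : ℕ} (X : Matrix (Fin n) (Fin P) ℝ) (θ : Fin P → ℝ)
    (σ : ℝ) : sampleLaw X θ σ = (stdNormal (Fin n)).map fun z => X *ᵥ θ + σ • z := by
  have h : (stdNormal (Fin n)).map (fun z => σ • z)
      = Measure.pi fun _ : Fin n => gaussianReal 0 (σ ^ 2).toNNReal := by
    have h1 : (gaussianReal 0 1).map (fun x => σ * x) = gaussianReal 0 (σ ^ 2).toNNReal := by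
      rw [gaussianReal_map_const_mul]
      congr 1
      · simp
      · ext; simp [sq_nonneg]
    rw [← h1, ← Measure.pi_map_pi fun _ => by fun_prop]
    rfl
  rw [sampleLaw, ← h, Measure.map_map (by fun_prop) (by fun_prop)]
  rfl


/-! ### Consistency of the variance estimator -/

/-- The bound does not involve `θ` and `σ`. -/
theorem sampleLaw_sigmaHat_div_sub_one_ge_le {n P : ℕ} {X : Matrix (Fin n) (Fin P) ℝ}
    (hX : X.rank = P) (hn : P < n) (θ : Fin P → ℝ) {σ : ℝ} (hσ : 0 < σ) {δ t : ℝ}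
    (ht : t = δ * ((n : ℝ) - P) / 2) (hPt : (P : ℝ) < t) :
    sampleLaw X θ σ {y | δ ≤ |sigmaHat X y / σ - 1|}
      ≤ ENNReal.ofReal (n * varSq / t ^ 2) + ENNReal.ofReal (P / t) := by
  have hnP : (0 : ℝ) < (n : ℝ) - P := sub_pos.2 (by exact_mod_cast hn)
  have ht0 : 0 < t := (Nat.cast_nonneg P).trans_lt hPt
  have hmeas := measurable_sigmaHat X
  rw [sampleLaw_eq_map_stdNormal, Measure.map_apply (by fun_prop)
    (measurableSet_le measurable_const (by fun_prop))]
  have hH : (hatMatrix X * (hatMatrix X)ᵀ).trace = P := by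
    rw [hatMatrix_transpose, hatMatrix_mul_self hX, trace_hatMatrix hX]
  have h1 := stdNormal_dotProduct_self_sub_ge_le n ht0
  have h2 := stdNormal_mulVec_dotProduct_ge_le (hatMatrix X) ht0
  rw [hH] at h2
  refine (measure_mono fun z hz => ?_).trans ((measure_union_le _ _).trans (add_le_add h1 h2))
  by_contra hcon
  simp only [Set.mem_union, Set.mem_ofPred_eq, not_or, not_le] at hcon
  obtain ⟨hz1, hz2⟩ := hcon
  simp only [Set.mem_preimage, Set.mem_ofPred_eq] at hz
  set hh := (hatMatrix X *ᵥ z) ⬝ᵥ (hatMatrix X *ᵥ z) with hhdef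
  have hh0 : 0 ≤ hh := Finset.sum_nonneg fun i _ => mul_self_nonneg _
  set s := sigmaHat X (X *ᵥ θ + σ • z) / σ with hs
  have hs0 : 0 ≤ s := div_nonneg (Real.sqrt_nonneg _) hσ.le
  have hss : s ^ 2 * (n - P) = z ⬝ᵥ z - hh := by
    have hres := residual_dotProduct_self hX θ σ z
    have h0 : 0 ≤ residual X (X *ᵥ θ + σ • z) ⬝ᵥ residual X (X *ᵥ θ + σ • z) :=
      Finset.sum_nonneg fun i _ => mul_self_nonneg _
    rw [hs, div_pow, sigmaHat, Real.sq_sqrt (mul_nonneg (inv_nonneg.2 hnP.le) h0), hres, ← hhdef]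
    field_simp
  rw [abs_lt] at hz1
  have hs1 : |s ^ 2 - 1| < δ := by
    have h3 : |(s ^ 2 - 1) * (n - P)| < δ * (n - P) := by
      rw [sub_mul, hss, one_mul, abs_lt]
      have hP0 : (0 : ℝ) ≤ P := Nat.cast_nonneg P
      constructor <;> linarith [hz1.1, hz1.2]
    rw [abs_mul, abs_of_pos hnP] at h3
    exact lt_of_mul_lt_mul_right h3 hnP.le
  have hs2 : |s - 1| ≤ |s ^ 2 - 1| := by
    rw [show s ^ 2 - 1 = (s - 1) * (s + 1) by ring, abs_mul]
    refine le_mul_of_one_le_right (abs_nonneg _) ?_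
    rw [abs_of_nonneg (by linarith)]
    linarith
  exact absurd hz (not_le.2 (hs2.trans_lt hs1))

/-! ### Comparison of the two model selectors -/

/-- The selected order depends only on the tests of orders above `O`, because the test of order `O`
always rejects when its critical value is zero. -/
theorem selectOrder_congr {n P O : ℕ} (hO : O ≤ P) {c : ℕ → ℝ} (hcO : c O = 0)
    (X : Matrix (Fin n) (Fin P) ℝ) {s s' : ℝ} {y : Fin n → ℝ}
    (h : ∀ q, O < q → q ≤ P → (c q ≤ |testStat X s y q| ↔ c q ≤ |testStat X s' y q|)) :
    selectOrder c X s y = selectOrder c X s' y := by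
  classical
  have hO' (s : ℝ) : c O ≤ |testStat X s y O| := hcO ▸ abs_nonneg _
  have key : ∀ s s' : ℝ,
      (∀ q, O < q → q ≤ P → (c q ≤ |testStat X s y q| → c q ≤ |testStat X s' y q|)) →
      selectOrder c X s y ≤ selectOrder c X s' y := by
    intro s s' h
    have hle : selectOrder c X s y ≤ P := Nat.findGreatest_le P
    refine Nat.le_findGreatest hle ?_
    rcases (show O ≤ selectOrder c X s y from Nat.le_findGreatest hO (hO' s)).eq_or_lt
      with heq | hlt
    · rw [← heq]; exact hO' s'
    · exact h _ hlt hle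
        (Nat.findGreatest_spec (P := fun p => c p ≤ |testStat X s y p|) hO (hO' s))
  exact le_antisymm (key _ _ fun q h1 h2 => (h q h1 h2).1) (key _ _ fun q h1 h2 => (h q h1 h2).2)

/-- If the two standard deviations differ by a factor close to one, a test can come out differently
only if the test statistic is close to its critical value. -/
theorem critical_le_abs_testStat_iff {n P : ℕ} (X : Matrix (Fin n) (Fin P) ℝ) {s σ δ c : ℝ}
    (hσ : 0 < σ) (hc : 0 < c) (hδ : δ < 1) (hs : |s / σ - 1| < δ) (y : Fin n → ℝ) (q : ℕ)
    (hfar : c * δ < |(|testStat X σ y q| - c)|) :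
    c ≤ |testStat X s y q| ↔ c ≤ |testStat X σ y q| := by
  rw [abs_lt] at hs
  have hr : 0 < s / σ := by linarith [hs.1]
  have h1 : σ / s = (s / σ)⁻¹ := (inv_div s σ).symm
  rw [testStat_eq_mul_div X s hσ.ne' y q, h1, abs_mul, abs_of_pos (inv_pos.2 hr),
    ← div_eq_mul_inv, le_div_iff₀ hr]
  have hu : c * (s / σ) < c * (1 + δ) := mul_lt_mul_of_pos_left (by linarith [hs.2]) hc
  have hl : c * (1 - δ) < c * (s / σ) := mul_lt_mul_of_pos_left (by linarith [hs.1]) hc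
  have hδ0 : 0 < c * δ := mul_pos hc (by linarith [hs.1, hs.2])
  rcases lt_abs.1 hfar with h | h
  · constructor <;> intro _ <;> linarith
  · constructor <;> intro _ <;> linarith

theorem sampleLaw_abs_testStat_near_le {n P : ℕ} {X : Matrix (Fin n) (Fin P) ℝ}
    (hX : X.rank = P) (hn : 0 < n) {q : ℕ} (hq0 : 0 < q) (hq : q ≤ P) (θ : Fin P → ℝ) {σ : ℝ}
    (hσ : 0 < σ) (c d : ℝ) :
    sampleLaw X θ σ {y | |(|testStat X σ y q| - c)| ≤ d} ≤ ENNReal.ofReal (2 * d) * 2 := by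
  obtain ⟨q, rfl⟩ := Nat.exists_eq_add_one.2 hq0
  obtain ⟨m, a, ha, hT⟩ := exists_testStat_eq_affine hX hn (Nat.lt_of_succ_le hq) θ hσ
  have hmeas := measurable_testStat X (measurable_const (a := σ)) (q + 1)
  rw [sampleLaw_eq_map_stdNormal, Measure.map_apply (by fun_prop)
    (measurableSet_le (by fun_prop) measurable_const)]
  have h1 := stdNormal_affine_mem_Icc_le a ha m (c - d) (c + d)
  have h2 := stdNormal_affine_mem_Icc_le a ha m (-c - d) (-c + d)
  rw [show c + d - (c - d) = 2 * d by ring] at h1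
  rw [show -c + d - (-c - d) = 2 * d by ring] at h2
  rw [mul_two]
  refine (measure_mono fun z hz => ?_).trans ((measure_union_le _ _).trans (add_le_add h1 h2))
  simp only [Set.mem_preimage, Set.mem_ofPred_eq, hT, abs_le] at hz
  simp only [Set.mem_union, Set.mem_ofPred_eq, Set.mem_Icc]
  rcases le_total 0 (m + a ⬝ᵥ z) with h | h
  · rw [abs_of_nonneg h] at hz
    left; constructor <;> linarith [hz.1, hz.2]
  · rw [abs_of_nonpos h] at hz
    right; constructor <;> linarith [hz.1, hz.2]

open scoped symmDiff in
theorem sampleLaw_symmDiff_orderHat_orderStar_le {n P O : ℕ} {X : Matrix (Fin n) (Fin P) ℝ}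
    (hX : X.rank = P) (hn : P < n) (hO : O ≤ P) {c : ℕ → ℝ} (hcO : c O = 0)
    (hc : ∀ q, O < q → q ≤ P → 0 < c q) (p : ℕ) (θ : Fin P → ℝ) {σ : ℝ} (hσ : 0 < σ) {δ : ℝ}
    (hδ : δ < 1) :
    sampleLaw X θ σ ({y | orderHat c X y = p} ∆ {y | orderStar c X σ y = p})
      ≤ sampleLaw X θ σ {y | δ ≤ |sigmaHat X y / σ - 1|}
        + ∑ q ∈ Finset.Ioc O P, ENNReal.ofReal (2 * (c q * δ)) * 2 := by
  have hsub : {y | orderHat c X y = p} ∆ {y | orderStar c X σ y = p}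
      ⊆ {y | δ ≤ |sigmaHat X y / σ - 1|}
        ∪ ⋃ q ∈ Finset.Ioc O P, {y | |(|testStat X σ y q| - c q)| ≤ c q * δ} := by
    intro y hy
    by_contra hcon
    simp only [Set.mem_union, Set.mem_iUnion, Set.mem_ofPred_eq, not_or, not_le, not_exists,
      Finset.mem_Ioc] at hcon
    have heq : orderHat c X y = orderStar c X σ y :=
      selectOrder_congr hO hcO X fun q h1 h2 =>
        critical_le_abs_testStat_iff X hσ (hc q h1 h2) hδ hcon.1 y q (hcon.2 q ⟨h1, h2⟩)
    simp [Set.mem_symmDiff, heq] at hy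
  refine (measure_mono hsub).trans ((measure_union_le _ _).trans (add_le_add le_rfl ?_))
  refine (measure_biUnion_finset_le _ _).trans (Finset.sum_le_sum fun q hq => ?_)
  rw [Finset.mem_Ioc] at hq
  exact sampleLaw_abs_testStat_near_le hX (by omega) (by omega) hq.2 θ hσ (c q) (c q * δ)

/-! ### Total variation of the weighted conditional laws -/

theorem weightedCondLaw_apply {n P k O p : ℕ} (hOp : O ≤ p) (hpP : p ≤ P)
    (A : Matrix (Fin k) (Fin P) ℝ) (X : Matrix (Fin n) (Fin P) ℝ) (θ : Fin P → ℝ) (σ : ℝ)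
    {sel : (Fin n → ℝ) → ℕ} (hsel : Measurable sel) {B : Set (Fin k → ℝ)} (hB : MeasurableSet B) :
    weightedCondLaw O A X θ σ sel p B = (sampleLaw X θ σ).real
      ({y | sel y = p} ∩ (fun y => √(n : ℝ) • (A *ᵥ (restrictedLS X p y - θ))) ⁻¹' B) := by
  have hE : MeasurableSet {y | sel y = p} := hsel (measurableSet_singleton p)
  have hpost : Measurable (postEstimator O X sel) := by
    unfold postEstimator
    exact Finset.measurable_fun_sum _ fun q _ =>
      Measurable.ite (hsel (measurableSet_singleton q)) (measurable_restrictedLS X q)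
        measurable_const
  have hmeas : Measurable (scaledError O A X θ sel) := by
    unfold scaledError mulVec dotProduct
    fun_prop
  have hset : {y | sel y = p} ∩ scaledError O A X θ sel ⁻¹' B = {y | sel y = p} ∩
      (fun y => √(n : ℝ) • (A *ᵥ (restrictedLS X p y - θ))) ⁻¹' B := by
    ext y
    simp only [Set.mem_inter_iff, Set.mem_ofPred_eq, Set.mem_preimage]
    refine and_congr_right fun hy => ?_
    rw [scaledError, postEstimator, hy, Finset.sum_ite_eq, if_pos (Finset.mem_Icc.2 ⟨hOp, hpP⟩)]
  rw [weightedCondLaw, _root_.smul_apply,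
    Measure.toSignedMeasure_apply_measurable hB, condLaw, selProb,
    map_measureReal_apply hmeas hB, measureReal_def (cond _ _), cond_apply hE,
    ENNReal.toReal_mul, ENNReal.toReal_inv, ← measureReal_def, ← measureReal_def, hset, smul_eq_mul]
  rcases eq_or_ne ((sampleLaw X θ σ).real {y | sel y = p}) 0 with h0 | h0
  · rw [h0, zero_mul]
    exact (measureReal_mono_null Set.inter_subset_left h0).symm
  · rw [mul_inv_cancel_left₀ h0]

open scoped symmDiff in
/-- The two weighted conditional laws are images, under one and the same map, of the restrictions
of the sample law to the two selection events. -/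
theorem tvDistance_weightedCondLaw_le {n P k O p : ℕ} (hOp : O ≤ p) (hpP : p ≤ P)
    (A : Matrix (Fin k) (Fin P) ℝ) (X : Matrix (Fin n) (Fin P) ℝ) (θ : Fin P → ℝ) (σ : ℝ)
    {sel sel' : (Fin n → ℝ) → ℕ} (hsel : Measurable sel) (hsel' : Measurable sel') :
    tvDistance (weightedCondLaw O A X θ σ sel p) (weightedCondLaw O A X θ σ sel' p)
      ≤ sampleLaw X θ σ ({y | sel y = p} ∆ {y | sel' y = p}) := by
  set Z : (Fin n → ℝ) → Fin k → ℝ := fun y => √(n : ℝ) • (A *ᵥ (restrictedLS X p y - θ)) with hZ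
  have hZm : Measurable Z := by
    have := measurable_restrictedLS X p
    unfold Z mulVec dotProduct
    fun_prop
  have hE : MeasurableSet {y | sel y = p} := hsel (measurableSet_singleton p)
  have hE' : MeasurableSet {y | sel' y = p} := hsel' (measurableSet_singleton p)
  set D := {y | sel y = p} ∆ {y | sel' y = p} with hD
  have hle : (weightedCondLaw O A X θ σ sel p - weightedCondLaw O A X θ σ sel' p).variation
      ≤ ((sampleLaw X θ σ).restrict D).map Z := by
    refine VectorMeasure.variation_le_of_forall_enorm_le fun B hB => ?_
    have hBm := hZm hB
    rw [_root_.sub_apply, weightedCondLaw_apply hOp hpP A X θ σ hsel hB,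
      weightedCondLaw_apply hOp hpP A X θ σ hsel' hB, Measure.map_apply hZm hB,
      Measure.restrict_apply hBm, ← ofReal_norm, Real.norm_eq_abs]
    refine (ENNReal.ofReal_le_ofReal (abs_measureReal_sub_le_measureReal_symmDiff
      (hE.inter hBm).nullMeasurableSet (hE'.inter hBm).nullMeasurableSet)).trans ?_
    rw [ofReal_measureReal]
    refine measure_mono ?_
    rintro y (⟨⟨h1, h2⟩, h3⟩ | ⟨⟨h1, h2⟩, h3⟩)
    · exact ⟨h2, Or.inl ⟨h1, fun h => h3 ⟨h, h2⟩⟩⟩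
    · exact ⟨h2, Or.inr ⟨h1, fun h => h3 ⟨h, h2⟩⟩⟩
  refine (hle Set.univ).trans ?_
  rw [Measure.map_apply hZm MeasurableSet.univ, Set.preimage_univ, Measure.restrict_apply_univ]

/-! ### Uniform convergence -/

theorem tendsto_sigmaHat_deviation_bound (P : ℕ) {δ : ℝ} (hδ : 0 < δ) :
    Tendsto (fun n : ℕ => ENNReal.ofReal (n * varSq / (δ * ((n : ℝ) - P) / 2) ^ 2)
      + ENNReal.ofReal (P / (δ * ((n : ℝ) - P) / 2))) atTop (𝓝 0) := by
  have hcast : Tendsto (fun n : ℕ => (n : ℝ) - P) atTop atTop :=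
    tendsto_atTop_add_const_right _ _ tendsto_natCast_atTop_atTop
  have ht : Tendsto (fun n : ℕ => δ * ((n : ℝ) - P) / 2) atTop atTop :=
    (hcast.const_mul_atTop hδ).atTop_div_const two_pos
  have h2 : Tendsto (fun n : ℕ => (P : ℝ) / (δ * ((n : ℝ) - P) / 2)) atTop (𝓝 0) :=
    ht.const_div_atTop _
  have h1 : Tendsto (fun n : ℕ => n * varSq / (δ * ((n : ℝ) - P) / 2) ^ 2) atTop (𝓝 0) := by
    have h3 : Tendsto (fun n : ℕ => (2 / δ + P / (δ * ((n : ℝ) - P) / 2)) *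
        (varSq / (δ * ((n : ℝ) - P) / 2))) atTop (𝓝 ((2 / δ + 0) * 0)) :=
      (tendsto_const_nhds.add h2).mul (ht.const_div_atTop _)
    rw [mul_zero] at h3
    refine h3.congr' ?_
    filter_upwards [eventually_gt_atTop P] with n hn
    have hnP : (n : ℝ) - P ≠ 0 := (sub_pos.2 (by exact_mod_cast hn)).ne'
    field_simp
    ring
  simpa using (ENNReal.tendsto_ofReal h1).add (ENNReal.tendsto_ofReal h2)

end PostModelSelection

theorem lemma4p1 (P O k : ℕ) (hP : 1 ≤ P) (hO : O < P) (hk : 1 ≤ k)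
    (A : Matrix (Fin k) (Fin P) ℝ) (hA : A.rank = k)
    (X : (n : ℕ) → Matrix (Fin n) (Fin P) ℝ) (hX : ∀ n, P < n → (X n).rank = P)
    (Q : Matrix (Fin P) (Fin P) ℝ) (hQ : Q.det ≠ 0)
    (hXQ : Tendsto (fun n : ℕ => (n : ℝ)⁻¹ • ((X n)ᵀ * X n)) atTop (𝓝 Q))
    (c : ℕ → ℝ) (hcO : c O = 0) (hc : ∀ q, O < q → q ≤ P → 0 < c q)
    (p : ℕ) (hOp : O ≤ p) (hpP : p ≤ P) :
    Tendsto (fun n : ℕ => ⨆ (θ : Fin P → ℝ) (σ : ℝ) (_ : 0 < σ),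
        PostModelSelection.tvDistance
          (PostModelSelection.weightedCondLaw O A (X n) θ σ
            (PostModelSelection.orderHat c (X n)) p)
          (PostModelSelection.weightedCondLaw O A (X n) θ σ
            (PostModelSelection.orderStar c (X n) σ) p))
      atTop (𝓝 0) := by
  have hsmall : Tendsto (fun δ : ℝ => ∑ q ∈ Finset.Ioc O P, ENNReal.ofReal (2 * (c q * δ)) * 2)
      (𝓝[>] 0) (𝓝 0) := by
    have hq (q : ℕ) : Tendsto (fun δ : ℝ => ENNReal.ofReal (2 * (c q * δ)) * 2) (𝓝 0) (𝓝 0) := by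
      have h1 : Tendsto (fun δ : ℝ => 2 * (c q * δ)) (𝓝 0) (𝓝 0) := by
        have h2 : Continuous fun δ : ℝ => 2 * (c q * δ) := by fun_prop
        simpa using h2.tendsto 0
      simpa using ENNReal.Tendsto.mul_const (ENNReal.tendsto_ofReal h1)
        (Or.inr (by simp : (2 : ℝ≥0∞) ≠ ∞))
    simpa using (tendsto_finsetSum (Finset.Ioc O P) fun q _ => hq q).mono_left nhdsWithin_le_nhds
  rw [ENNReal.tendsto_nhds_zero]
  intro ε hε
  have hε2 : 0 < ε / 2 := ENNReal.half_pos hε.ne'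
  -- First `δ` is chosen to make the tests' contribution small for all `n`, then `n` is let grow.
  obtain ⟨δ, hδε, hδ0, hδ1⟩ := ((ENNReal.tendsto_nhds_zero.1 hsmall _ hε2).and
    (Ioo_mem_nhdsGT (zero_lt_one (α := ℝ)))).exists
  have ht : Tendsto (fun n : ℕ => δ * ((n : ℝ) - P) / 2) atTop atTop :=
    ((tendsto_atTop_add_const_right _ _ tendsto_natCast_atTop_atTop).const_mul_atTop
      hδ0).atTop_div_const two_pos
  filter_upwards [eventually_gt_atTop P, ht.eventually_gt_atTop (P : ℝ),
    ENNReal.tendsto_nhds_zero.1 (PostModelSelection.tendsto_sigmaHat_deviation_bound P hδ0) _ hε2]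
    with n hn hPt hdev
  refine iSup_le fun θ => iSup_le fun σ => iSup_le fun hσ => ?_
  calc _ ≤ _ := PostModelSelection.tvDistance_weightedCondLaw_le hOp hpP A (X n) θ σ
        (PostModelSelection.measurable_selectOrder c (X n)
          (PostModelSelection.measurable_sigmaHat (X n)))
        (PostModelSelection.measurable_selectOrder c (X n) measurable_const)
    _ ≤ _ := PostModelSelection.sampleLaw_symmDiff_orderHat_orderStar_le (hX n hn) hn hO.le hcO hc
        p θ hσ hδ1
    _ ≤ ε / 2 + ε / 2 := add_le_add
        ((PostModelSelection.sampleLaw_sigmaHat_div_sub_one_ge_le (hX n hn) hn θ hσ rfl hPt).trans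
          hdev) hδε
    _ = ε := ENNReal.add_halves ε
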